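/- Let $\Omega\subset\mathbb R^D$, let $\mathsf d$ be a metric on $\Omega$ whose open balls $B(x,r)=\{y\in\Omega:\mathsf d(x,y)<r\}$ are Borel sets, and let $\mathsf m$ be a positive Borel measure on $\Omega$ (for instance the Lebesgue measure of a solid domain, or the surface measure of an algebraic surface). A weight is a nonnegative $\mathsf m$-integrable function $w$ on $\Omega$; put $w(E)=\int_E w\,d\mathsf m$. The weight $w$ is doubling if there is $L>0$ with $w(B(x,2r))\le L\,w(B(x,r))$ for all $x\in\Omega$, $r>0$. Let $\Pi_n(\Omega)$ be the space of real polynomials in $D$ variables of total degree at most $n$, restricted to $\Omega$. The Christoffel function is $$\lambda_n(w;x)=\inf\Big\{\int_\Omega |g|^2\,w\,d\mathsf m:\ g\in\Pi_n(\Omega),\ g(x)=1\Big\}.$$ (i) Suppose that $\Omega$ is compact and has fast decaying polynomials: for every $\gamma>1$ there are constants $\delta,c_\gamma,c_1,c_2>0$ and a positive integer $r$ such that for every $n\ge1$ there are functions $T_x\in\Pi_n(\Omega)$ $(x\in\Omega)$ and a polynomial $q_n$ with (1) $T_x(x)=1$, $T_x(y)\ge\delta$ for $y\in B(x,\frac1n)$,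 and $0\le T_x(y)\le c_\gamma(1+n\,\mathsf d(x,y))^{-\gamma}$ for all $x,y\in\Omega$; (2) for each $y\in\Omega$ the function $x\mapsto q_n(x)T_x(y)$ belongs to $\Pi_{rn}(\Omega)$, and $c_1\le q_n(x)\le c_2$ for $x\in\Omega$. Then for every doubling weight $w$ there is a constant $c>0$, independent of $n$ and $x$, such that $$\lambda_n(w;x)\le c\,w\big(B(x,\tfrac1n)\big),\qquad x\in\Omega,\ n=1,2,\dots.$$ (ii) Let $w$ be a weight for which $\langle f,g\rangle_w=\int_\Omega fg\,w\,d\mathsf m$ is a well-defined inner product on the space of polynomials restricted to $\Omega$ (all polynomials are integrable against $w$, and the form is positive definite). Let $P_0(w;\cdot,\cdot)$ be the reproducing kernel of $\Pi_0(\Omega)$ and, for $k\ge1$, let $P_k(w;\cdot,\cdot)$ be the reproducing kernel of the orthogonal complement of $\Pi_{k-1}(\Omega)$ in $\Pi_k(\Omega)$, both with respect to $\langle\cdot,\cdot\rangle_w$. Let $\widehat a\in C^\infty([0,\infty))$ be nonnegative, supported in $[0,2]$, with $\widehat a=1$ on $[0,1]$, and let $L_n(w;x,y)=\sum_{k\ge0}\widehat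 a(k/n)P_k(w;x,y)$. Suppose that for every $\kappa>0$ there is $c_\kappa$ such that for all $n\ge1$ and $x,y\in\Omega$ $$|L_n(w;x,y)|\le \frac{c_\kappa}{\sqrt{w(B(x,\frac1n))}\,\sqrt{w(B(y,\frac1n))}\,\big(1+n\,\mathsf d(x,y)\big)^{\kappa}}$$ (the right-hand side being read as $+\infty$ where its denominator vanishes). Then there is a constant $c>0$, independent of $n$ and $x$, such that $$\lambda_n(w;x)\ge c\,w\big(B(x,\tfrac1n)\big),\qquad x\in\Omega,\ n=1,2,\dots.$$ -/

import Mathlib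

open MeasureTheory
open scoped ContDiff

noncomputable section

/-! ### The domain, its distance and weights

The domain is a set `Ω ⊆ ℝ^D`, used as a subtype with its Borel structure; `m` is a positive measure
on `Ω` (for example the restricted Lebesgue measure of a solid domain or the surface measure of an
algebraic surface) and `d` is an intrinsic distance on `Ω`. -/

/-- The axioms of a metric for `d : X → X → ℝ`. -/
structure IsDistance {X : Type*} (d : X → X → ℝ) : Prop where
  eq_zero_iff : ∀ x y, d x y = 0 ↔ x = y
  symm : ∀ x y, d x y = d y x
  triangle : ∀ x y z, d x z ≤ d x y + d y z

/-- The open ball `B(x, r)` of the distance `d`. -/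
def dBall {X : Type*} (d : X → X → ℝ) (x : X) (r : ℝ) : Set X := {y | d x y < r}

/-- `w(E) = ∫_E w dm`. -/
def weightMass {X : Type*} [MeasurableSpace X] (m : Measure X) (w : X → ℝ) (E : Set X) : ℝ :=
  ∫ y in E, w y ∂m

/-- A weight function: nonnegative and integrable. -/
structure IsWeight {X : Type*} [MeasurableSpace X] (m : Measure X) (w : X → ℝ) : Prop where
  nonneg : ∀ x, 0 ≤ w x
  integrable : Integrable w m

/-- The doubling condition `w(B(x, 2r)) ≤ L w(B(x, r))` for all centers and all radii. -/
def IsDoublingWeight {X : Type*} [MeasurableSpace X] (d : X → X → ℝ) (m : Measure X)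
    (w : X → ℝ) : Prop :=
  IsWeight m w ∧ ∃ L : ℝ, 0 < L ∧ ∀ (x : X) (r : ℝ), 0 < r →
    weightMass m w (dBall d x (2 * r)) ≤ L * weightMass m w (dBall d x r)

/-! ### Polynomials on the domain -/

/-- Restriction of a polynomial in `D` variables to a function on `Ω`. -/
def polyRestrict {D : ℕ} (Ω : Set (EuclideanSpace ℝ (Fin D))) :
    MvPolynomial (Fin D) ℝ →ₗ[ℝ] (Ω → ℝ) where
  toFun p := fun x => MvPolynomial.eval (fun i => (x : EuclideanSpace ℝ (Fin D)) i) p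
  map_add' p q := by ext x; simp
  map_smul' c p := by ext x; simp

/-- `Π_n(Ω)`: polynomials of (total) degree at most `n`, restricted to `Ω`. -/
def polySpace {D : ℕ} (Ω : Set (EuclideanSpace ℝ (Fin D))) (n : ℕ) : Submodule ℝ (Ω → ℝ) :=
  (MvPolynomial.restrictTotalDegree (Fin D) ℝ n).map (polyRestrict Ω)

/-- `⟨f, g⟩_w = ∫_Ω f g w dm`. -/
def weightedInner {X : Type*} [MeasurableSpace X] (m : Measure X) (w f g : X → ℝ) : ℝ :=
  ∫ y, f y * g y * w y ∂m

/-- The form `⟨·,·⟩_w` is a well-defined inner product on the space `Π(Ω)` of polynomials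
restricted to `Ω`: all polynomials are integrable against `w` (hence so are products of two
polynomials), and the form is positive definite. -/
structure IsPolyInnerProduct {D : ℕ} {Ω : Set (EuclideanSpace ℝ (Fin D))} (m : Measure Ω)
    (w : Ω → ℝ) : Prop where
  integrable : ∀ p : MvPolynomial (Fin D) ℝ, Integrable (fun y => polyRestrict Ω p y * w y) m
  pos_def : ∀ p : MvPolynomial (Fin D) ℝ, polyRestrict Ω p ≠ 0 →
    0 < weightedInner m w (polyRestrict Ω p) (polyRestrict Ω p)

/-- `V_n(Ω, w)`: the orthogonal polynomials of degree `n`, that is, the elements of `Π_n(Ω)` which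
are orthogonal to all polynomials of lower degree (no condition when `n = 0`). -/
def orthoPolys {D : ℕ} {Ω : Set (EuclideanSpace ℝ (Fin D))} (m : Measure Ω) (w : Ω → ℝ)
    (n : ℕ) : Set (Ω → ℝ) :=
  {f | f ∈ polySpace Ω n ∧ ∀ k < n, ∀ g ∈ polySpace Ω k, weightedInner m w f g = 0}

/-- `P` is a reproducing kernel of `V_n(Ω, w)`. -/
def IsReproducingKernel {D : ℕ} {Ω : Set (EuclideanSpace ℝ (Fin D))} (m : Measure Ω) (w : Ω → ℝ)
    (n : ℕ) (P : Ω → Ω → ℝ) : Prop :=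
  (∀ x, P x ∈ orthoPolys m w n) ∧
    ∀ f ∈ orthoPolys m w n, ∀ x, ∫ y, f y * P x y * w y ∂m = f x

/-- If `⟨·,·⟩_w` is an inner product on the polynomials, then `V_n(Ω, w)` has exactly one
reproducing kernel. -/
theorem existsUnique_reproducingKernel {D : ℕ} {Ω : Set (EuclideanSpace ℝ (Fin D))}
    (m : Measure Ω) (w : Ω → ℝ) (hw : IsPolyInnerProduct m w) (n : ℕ) :
    ∃! P : Ω → Ω → ℝ, IsReproducingKernel m w n P := by
  have hpoly : ∀ k, ∀ f ∈ polySpace Ω k, ∃ p, polyRestrict Ω p = f := by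
    rintro k f ⟨p, -, rfl⟩
    exact ⟨p, rfl⟩
  have hint : ∀ j k, ∀ f ∈ polySpace Ω j, ∀ g ∈ polySpace Ω k,
      Integrable (fun y => f y * g y * w y) m := by
    intro j k f hf g hg
    obtain ⟨p, rfl⟩ := hpoly j f hf
    obtain ⟨q, rfl⟩ := hpoly k g hg
    simpa [polyRestrict] using hw.integrable (p * q)
  have hadd : ∀ j k, ∀ f₁ ∈ polySpace Ω j, ∀ f₂ ∈ polySpace Ω j, ∀ g ∈ polySpace Ω k,
      weightedInner m w (f₁ + f₂) g = weightedInner m w f₁ g + weightedInner m w f₂ g := by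
    intro j k f₁ h₁ f₂ h₂ g hg
    unfold weightedInner
    rw [← integral_add (hint j k f₁ h₁ g hg) (hint j k f₂ h₂ g hg)]
    congr 1; ext y; simp only [Pi.add_apply]; ring
  have hsmul : ∀ (c : ℝ) (f g : Ω → ℝ),
      weightedInner m w (c • f) g = c * weightedInner m w f g := by
    intro c f g
    unfold weightedInner
    rw [← integral_const_mul]
    congr 1; ext y; simp only [Pi.smul_apply, smul_eq_mul]; ring
  have hcomm : ∀ f g : Ω → ℝ, weightedInner m w f g = weightedInner m w g f := by
    intro f g
    unfold weightedInner
    congr 1; ext y; ring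
  let V : Submodule ℝ (Ω → ℝ) :=
    { carrier := orthoPolys m w n
      add_mem' := by
        rintro f₁ f₂ ⟨h₁, h₁'⟩ ⟨h₂, h₂'⟩
        refine ⟨add_mem h₁ h₂, fun k hk g hg => ?_⟩
        rw [hadd n k f₁ h₁ f₂ h₂ g hg, h₁' k hk g hg, h₂' k hk g hg, add_zero]
      zero_mem' := ⟨zero_mem _, fun k hk g hg => by simp [weightedInner]⟩
      smul_mem' := by
        rintro c f ⟨h, h'⟩
        refine ⟨Submodule.smul_mem _ c h, fun k hk g hg => ?_⟩
        rw [hsmul, h' k hk g hg, mul_zero] }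
  have hVle : V ≤ polySpace Ω n := fun f hf => hf.1
  have : Module.Finite ℝ (polySpace Ω n) := by unfold polySpace; infer_instance
  have : FiniteDimensional ℝ V := Submodule.finiteDimensional_of_le hVle
  let B : V →ₗ[ℝ] V →ₗ[ℝ] ℝ := LinearMap.mk₂ ℝ
    (fun f g => weightedInner m w (f : Ω → ℝ) (g : Ω → ℝ))
    (fun f₁ f₂ g => hadd n n _ (hVle f₁.2) _ (hVle f₂.2) _ (hVle g.2))
    (fun c f g => hsmul c _ _)
    (fun f g₁ g₂ => by
      rw [hcomm, hcomm (f : Ω → ℝ) g₁, hcomm (f : Ω → ℝ) g₂]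
      exact hadd n n _ (hVle g₁.2) _ (hVle g₂.2) _ (hVle f.2))
    (fun c f g => by
      rw [hcomm, hcomm (f : Ω → ℝ) g]
      exact hsmul c _ _)
  have hinj : Function.Injective B := by
    rw [injective_iff_map_eq_zero]
    intro f hf
    by_contra hne
    obtain ⟨p, hp⟩ := hpoly n f (hVle f.2)
    have h0 : B f f = 0 := by rw [hf]; rfl
    have hpos := hw.pos_def p (by rw [hp]; simpa using hne)
    rw [hp] at hpos
    exact absurd h0 hpos.ne'
  have hsurj : Function.Surjective B :=
    (LinearMap.injective_iff_surjective_of_finrank_eq_finrank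
      (Subspace.dual_finrank_eq (K := ℝ) (V := V)).symm).1 hinj
  choose v hv using fun x : Ω => hsurj ((LinearMap.proj x).comp V.subtype)
  refine ⟨fun x => v x, ⟨fun x => (v x).2, fun f hf x => ?_⟩, ?_⟩
  · have h := LinearMap.congr_fun (hv x) ⟨f, hf⟩
    have h' : weightedInner m w (v x : Ω → ℝ) f = f x := h
    rw [hcomm] at h'
    exact h'
  · rintro Q ⟨hQ, hQ'⟩
    funext x
    have : (⟨Q x, hQ x⟩ : V) = v x := by
      apply hinj
      rw [hv x]
      ext f
      have h := hQ' f f.2 x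
      change weightedInner m w (f : Ω → ℝ) (Q x) = (f : Ω → ℝ) x at h
      rw [hcomm] at h
      exact h
    exact congrArg Subtype.val this

open Classical in
/-- `P_n(w; ·, ·)`: the reproducing kernel of `V_n(Ω, w)` (it exists and is unique when `⟨·,·⟩_w` is
an inner product on the polynomials, see `existsUnique_reproducingKernel`). -/
def reproducingKernel {D : ℕ} {Ω : Set (EuclideanSpace ℝ (Fin D))} (m : Measure Ω) (w : Ω → ℝ)
    (n : ℕ) : Ω → Ω → ℝ :=
  if h : ∃ P : Ω → Ω → ℝ, IsReproducingKernel m w n P then h.choose else 0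

/-! ### Localized kernels -/

/-- Admissible cut-off functions of type (a): `a ∈ C^∞([0, ∞))` is nonnegative, supported in
`[0, 2]`, and equal to `1` on `[0, 1]`. Only the values of `a` on `[0, ∞)` matter. -/
structure IsCutoffA (a : ℝ → ℝ) : Prop where
  smooth : ContDiffOn ℝ ∞ a (Set.Ici 0)
  nonneg : ∀ t, 0 ≤ t → 0 ≤ a t
  eq_zero : ∀ t, 2 < t → a t = 0
  eq_one : ∀ t ∈ Set.Icc (0 : ℝ) 1, a t = 1

/-- `L_n(w; x, y) = ∑_{k ≥ 0} a(k / n) P_k(w; x, y)` for `n ≥ 1`; the sum is finite because `a`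
vanishes on `(2, ∞)`. -/
def localizedKernel {D : ℕ} {Ω : Set (EuclideanSpace ℝ (Fin D))} (m : Measure Ω) (w : Ω → ℝ)
    (a : ℝ → ℝ) (n : ℕ) (x y : Ω) : ℝ :=
  ∑' k : ℕ, a ((k : ℝ) / n) * reproducingKernel m w k x y

/-- The decay estimate
`|L_n(w; x, y)| ≤ c_κ / (√w(B(x, 1/n)) √w(B(y, 1/n)) (1 + n d(x, y))^κ)` for every `κ > 0`, with
`c_κ` independent of `n ≥ 1` and of `x, y ∈ Ω`. The denominator is multiplied out, so that the
right-hand side counts as `+∞` where a ball has mass zero. -/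
def AdmitsLocalizedDecay {D : ℕ} {Ω : Set (EuclideanSpace ℝ (Fin D))} (d : Ω → Ω → ℝ)
    (m : Measure Ω) (w : Ω → ℝ) (a : ℝ → ℝ) : Prop :=
  ∀ κ : ℝ, 0 < κ → ∃ c : ℝ, 0 < c ∧ ∀ n : ℕ, 1 ≤ n → ∀ x y : Ω,
    |localizedKernel m w a n x y| *
      (Real.sqrt (weightMass m w (dBall d x (1 / n))) *
        Real.sqrt (weightMass m w (dBall d y (1 / n))) * (1 + n * d x y) ^ κ) ≤ c

/-! ### Fast decaying polynomials -/

/-- Existence of fast decaying polynomials on a compact `Ω`. The polynomials `T x` (and the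
constants) may depend on the decay rate `γ`; the constants `δ, c, c₁, c₂, r` do not depend on
`n ≥ 1` nor on the points of `Ω`. -/
def HasFastDecayingPolynomials {D : ℕ} (Ω : Set (EuclideanSpace ℝ (Fin D)))
    (d : Ω → Ω → ℝ) : Prop :=
  IsCompact Ω ∧ ∀ γ : ℝ, 1 < γ →
    ∃ (δ c c₁ c₂ : ℝ) (r : ℕ), 0 < δ ∧ 0 < c ∧ 0 < c₁ ∧ 0 < c₂ ∧ 0 < r ∧
      ∀ n : ℕ, 1 ≤ n → ∃ (T : Ω → Ω → ℝ) (q : MvPolynomial (Fin D) ℝ),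
        (∀ x, T x ∈ polySpace Ω n ∧ T x x = 1 ∧ (∀ y ∈ dBall d x (1 / n), δ ≤ T x y) ∧
          ∀ y, 0 ≤ T x y ∧ T x y ≤ c * (1 + n * d x y) ^ (-γ)) ∧
        (∀ y, (fun x => polyRestrict Ω q x * T x y) ∈ polySpace Ω (r * n)) ∧
        ∀ x, c₁ ≤ polyRestrict Ω q x ∧ polyRestrict Ω q x ≤ c₂

/-! ### The Christoffel function -/

/-- `λ_n(w; x) = inf { ∫_Ω |g|² w dm : g ∈ Π_n(Ω), g(x) = 1 }`. -/
def christoffel {D : ℕ} {Ω : Set (EuclideanSpace ℝ (Fin D))} (m : Measure Ω) (w : Ω → ℝ)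
    (n : ℕ) (x : Ω) : ℝ :=
  sInf {I : ℝ | ∃ g ∈ polySpace Ω n, g x = 1 ∧ I = ∫ y, |g y| ^ 2 * w y ∂m}

end

/-! Upper bound: the fast decaying polynomial `T x` is itself a competitor in the infimum. Its
square is bounded near x and at most a multiple of 2^(-γj) where d(x, y) ≥ 2^j/n, whereas doubling
lets the mass of B(x, 2^j/n) grow by at most L^j. If γ is large compared with log₂ L, the sum over
dyadic shells is a convergent geometric series times w(B(x, 1/n)); this is
`integral_mul_weight_le_of_decay`.

Lower bound: K_n = P_0 + ... + P_n reproduces Π_n(Ω), so if g(x) = 1, Cauchy–Schwarz gives 1 ≤ ⟨g,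
g⟩ K_n(x, x) (`one_le_weightedInner_mul_partialKernel`). As P_k(x, x) ≥ 0, the cut-off sum dominates
on the diagonal: K_n(x, x) ≤ L_n(x, x) (`partialKernel_self_le_localizedKernel`). The decay estimate
at y = x bounds L_n(x, x) w(B(x, 1/n)) by a constant, and combining the three inequalities finishes.
-/

/-! ### Dyadic integration against a doubling weight -/

open Finset in
/-- Dyadic decomposition of a decaying function: if `f ≤ A` on the unit scale and
`f ≤ A q ^ j` outside the ball of radius `2 ^ j s`, then `f` is dominated by a dyadic sum of
indicators of balls, up to a small multiple of `1`. -/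
theorem le_sum_indicator_dBall {X : Type*} (d : X → X → ℝ) (x y : X) {s A q t : ℝ}
    (hA : 0 ≤ A) (hq : 0 ≤ q) (h0 : t ≤ A) (ht : ∀ j : ℕ, 2 ^ j * s ≤ d x y → t ≤ A * q ^ j)
    (N : ℕ) :
    t ≤ (dBall d x s).indicator (fun _ => A) y
      + ∑ j ∈ range N, (dBall d x (2 ^ (j + 1) * s)).indicator (fun _ => A * q ^ j) y
      + A * q ^ N := by
  have hind : ∀ (S : Set X) (b : ℝ), 0 ≤ b → 0 ≤ S.indicator (fun _ => b) y :=
    fun S b hb => Set.indicator_nonneg (fun _ _ => hb) y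
  have hsum : ∀ M : ℕ,
      0 ≤ ∑ j ∈ range M, (dBall d x (2 ^ (j + 1) * s)).indicator (fun _ => A * q ^ j) y :=
    fun M => sum_nonneg fun j _ => hind _ _ (by positivity)
  by_cases hs : d x y < s
  · have : (dBall d x s).indicator (fun _ => A) y = A := Set.indicator_of_mem (show y ∈ dBall d x s from hs) _
    have := hsum N
    have : 0 ≤ A * q ^ N := by positivity
    linarith
  have hfirst := hind (dBall d x s) A hA
  suffices h : t ≤
      ∑ j ∈ range N, (dBall d x (2 ^ (j + 1) * s)).indicator (fun _ => A * q ^ j) y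
        + A * q ^ N by linarith
  by_cases hN : 2 ^ N * s ≤ d x y
  · have := ht N hN
    have := hsum N
    linarith
  push Not at hN
  -- The induction finds the shell 2^j s ≤ d x y < 2^(j+1) s containing y; the indicator with index
  -- j alone then bounds t.
  induction N with
  | zero => simp at hN; exact absurd hN hs
  | succ N ih =>
    rw [sum_range_succ]
    by_cases hN' : 2 ^ N * s ≤ d x y
    · have h1 : (dBall d x (2 ^ (N + 1) * s)).indicator (fun _ => A * q ^ N) y = A * q ^ N :=
        Set.indicator_of_mem (show y ∈ dBall d x (2 ^ (N + 1) * s) from hN) _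
      have := ht N hN'
      have := hsum N
      have : 0 ≤ A * q ^ (N + 1) := by positivity
      linarith
    · push Not at hN'
      have h1 : (dBall d x (2 ^ (N + 1) * s)).indicator (fun _ => A * q ^ N) y = A * q ^ N :=
        Set.indicator_of_mem (show y ∈ dBall d x (2 ^ (N + 1) * s) from hN) _
      have := ih hN'
      have : 0 ≤ A * q ^ (N + 1) := by positivity
      linarith

theorem weightMass_nonneg {X : Type*} [MeasurableSpace X] {m : Measure X} {w : X → ℝ}
    (hw : ∀ x, 0 ≤ w x) (E : Set X) : 0 ≤ weightMass m w E :=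
  integral_nonneg hw

/-- Iterating the doubling condition. -/
theorem weightMass_dBall_two_pow_le {X : Type*} [MeasurableSpace X] {d : X → X → ℝ}
    {m : Measure X} {w : X → ℝ} {L : ℝ} (hL : 0 < L)
    (hdoub : ∀ (x : X) (r : ℝ), 0 < r →
      weightMass m w (dBall d x (2 * r)) ≤ L * weightMass m w (dBall d x r))
    (x : X) {s : ℝ} (hs : 0 < s) (j : ℕ) :
    weightMass m w (dBall d x (2 ^ j * s)) ≤ L ^ j * weightMass m w (dBall d x s) := by
  induction j with
  | zero => simp
  | succ j ih =>
    calc weightMass m w (dBall d x (2 ^ (j + 1) * s))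
        = weightMass m w (dBall d x (2 * (2 ^ j * s))) := by ring_nf
      _ ≤ L * weightMass m w (dBall d x (2 ^ j * s)) := hdoub _ _ (by positivity)
      _ ≤ L * (L ^ j * weightMass m w (dBall d x s)) := by gcongr
      _ = L ^ (j + 1) * weightMass m w (dBall d x s) := by ring

/-- A function with fast dyadic decay away from `x` has integral against a doubling weight
controlled by the mass of one ball around `x`. -/
theorem integral_mul_weight_le_of_decay {X : Type*} [MeasurableSpace X] {d : X → X → ℝ}
    {m : Measure X} {w : X → ℝ} (hw : IsWeight m w)
    (hball : ∀ (x : X) (r : ℝ), MeasurableSet (dBall d x r)) {L : ℝ} (hL : 0 < L)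
    (hdoub : ∀ (x : X) (r : ℝ), 0 < r →
      weightMass m w (dBall d x (2 * r)) ≤ L * weightMass m w (dBall d x r))
    (x : X) {s A q : ℝ} (hs : 0 < s) (hA : 0 ≤ A) (hq : 0 ≤ q) (hq1 : q < 1)
    (hqL : q * L ≤ 1 / 2) {f : X → ℝ} (hf : ∀ y, 0 ≤ f y) (h0 : ∀ y, f y ≤ A)
    (ht : ∀ y, ∀ j : ℕ, 2 ^ j * s ≤ d x y → f y ≤ A * q ^ j) :
    ∫ y, f y * w y ∂m ≤ A * (1 + 2 * L) * weightMass m w (dBall d x s) := by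
  set M := weightMass m w (dBall d x s) with hM
  have hM0 : 0 ≤ M := weightMass_nonneg hw.nonneg _
  have hint : ∀ (r b : ℝ),
      Integrable (fun y => (dBall d x r).indicator (fun _ => b) y * w y) m := by
    intro r b
    have : (fun y => (dBall d x r).indicator (fun _ => b) y * w y)
        = (dBall d x r).indicator (fun y => b * w y) := by
      ext y; by_cases hy : y ∈ dBall d x r <;> simp [hy]
    rw [this]
    exact (hw.integrable.const_mul b).indicator (hball x r)
  have hval : ∀ (r b : ℝ),
      ∫ y, (dBall d x r).indicator (fun _ => b) y * w y ∂m
        = b * weightMass m w (dBall d x r) := by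
    intro r b
    have : (fun y => (dBall d x r).indicator (fun _ => b) y * w y)
        = (dBall d x r).indicator (fun y => b * w y) := by
      ext y; by_cases hy : y ∈ dBall d x r <;> simp [hy]
    rw [this, integral_indicator (hball x r), integral_const_mul, weightMass]
  have hN : ∀ N : ℕ, ∫ y, f y * w y ∂m ≤
      A * (1 + 2 * L) * M + A * q ^ N * ∫ y, w y ∂m := by
    intro N
    have hS : Integrable (fun y => ∑ j ∈ Finset.range N,
        (dBall d x (2 ^ (j + 1) * s)).indicator (fun _ => A * q ^ j) y * w y) m :=
      integrable_finsetSum _ fun j _ => hint _ _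
    calc ∫ y, f y * w y ∂m
        ≤ ∫ y, ((dBall d x s).indicator (fun _ => A) y * w y
            + ∑ j ∈ Finset.range N,
              (dBall d x (2 ^ (j + 1) * s)).indicator (fun _ => A * q ^ j) y * w y)
            + A * q ^ N * w y ∂m := by
          -- Only the majorant has to be integrable: if f w is not, its integral is 0 by convention
          -- and the bound still holds.
          refine integral_mono_of_nonneg
            (Filter.Eventually.of_forall fun y => mul_nonneg (hf y) (hw.nonneg y))
            (((hint _ _).add hS).add (hw.integrable.const_mul _))
            (Filter.Eventually.of_forall fun y => ?_)
          have := mul_le_mul_of_nonneg_right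
            (le_sum_indicator_dBall d x y hA hq (h0 y) (ht y) N) (hw.nonneg y)
          simpa only [add_mul, Finset.sum_mul] using this
      _ = A * M + ∑ j ∈ Finset.range N,
            A * q ^ j * weightMass m w (dBall d x (2 ^ (j + 1) * s))
            + A * q ^ N * ∫ y, w y ∂m := by
          have h1 := integral_add ((hint s A).add hS) (hw.integrable.const_mul (A * q ^ N))
          simp only [Pi.add_apply] at h1
          rw [h1, integral_add (hint _ _) hS, integral_finsetSum _ fun j _ => hint _ _,
            integral_const_mul, hval]
          simp only [hval, hM]
      _ ≤ A * M + ∑ j ∈ Finset.range N, A * L * M * (1 / 2) ^ j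
            + A * q ^ N * ∫ y, w y ∂m := by
          refine add_le_add (add_le_add le_rfl (Finset.sum_le_sum fun j _ => ?_)) le_rfl
          calc A * q ^ j * weightMass m w (dBall d x (2 ^ (j + 1) * s))
              ≤ A * q ^ j * (L ^ (j + 1) * M) := by
                gcongr
                exact weightMass_dBall_two_pow_le hL hdoub x hs (j + 1)
            _ = A * L * M * (q * L) ^ j := by ring
            _ ≤ A * L * M * (1 / 2) ^ j := by gcongr
      _ ≤ A * M + A * L * M * 2 + A * q ^ N * ∫ y, w y ∂m := by
          rw [← Finset.mul_sum]
          gcongr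
          exact sum_geometric_two_le N
      _ = A * (1 + 2 * L) * M + A * q ^ N * ∫ y, w y ∂m := by ring
  -- The remainder is a multiple of q^N times the total mass of w, which is finite, so it disappears
  -- as N → ∞.
  have hlim : Filter.Tendsto
      (fun N : ℕ => A * (1 + 2 * L) * M + A * q ^ N * ∫ y, w y ∂m) Filter.atTop
      (nhds (A * (1 + 2 * L) * M + A * 0 * ∫ y, w y ∂m)) :=
    (((tendsto_pow_atTop_nhds_zero_of_lt_one hq hq1).const_mul A).mul_const _).const_add _
  simpa using ge_of_tendsto' hlim hN

/-! ### Upper bound for the Christoffel function -/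

theorem christoffel_le {D : ℕ} {Ω : Set (EuclideanSpace ℝ (Fin D))} {m : Measure Ω} {w : Ω → ℝ}
    (hw : ∀ x, 0 ≤ w x) {n : ℕ} {x : Ω} {g : Ω → ℝ} (hg : g ∈ polySpace Ω n) (hx : g x = 1) :
    christoffel m w n x ≤ ∫ y, |g y| ^ 2 * w y ∂m := by
  refine csInf_le ⟨0, ?_⟩ ⟨g, hg, hx, rfl⟩
  rintro _ ⟨f, -, -, rfl⟩
  exact integral_nonneg fun y => mul_nonneg (by positivity) (hw y)

/-- Upper bound for the Christoffel function of a doubling weight. -/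
theorem christoffel_le_of_doubling {D : ℕ} {Ω : Set (EuclideanSpace ℝ (Fin D))}
    {d : Ω → Ω → ℝ} (hd : IsDistance d)
    (hball : ∀ (x : Ω) (r : ℝ), MeasurableSet (dBall d x r)) {m : Measure Ω} {w : Ω → ℝ}
    (hfast : HasFastDecayingPolynomials Ω d) (hw : IsDoublingWeight d m w) :
    ∃ c : ℝ, 0 < c ∧ ∀ n : ℕ, 1 ≤ n → ∀ x : Ω,
      christoffel m w n x ≤ c * weightMass m w (dBall d x (1 / n)) := by
  obtain ⟨hw, L, hL, hdoub⟩ := hw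
  have hdnn : ∀ x y, 0 ≤ d x y := by
    intro x y
    have h1 := hd.triangle x y x
    have h2 := hd.symm x y
    have h3 := (hd.eq_zero_iff x x).2 rfl
    linarith
  -- With 2L < 2^K, the ratio q = 2^(-(K+2)) satisfies q L ≤ 1/2. The extra 2 forces γ > 1 even if K
  -- = 0, and an integral γ turns real powers into ordinary ones.
  obtain ⟨K, hK⟩ := pow_unbounded_of_one_lt (2 * L) (one_lt_two (α := ℝ))
  set γ : ℝ := ((K + 2 : ℕ) : ℝ) with hγ
  have hγ1 : 1 < γ := by rw [hγ]; exact_mod_cast (by omega : 1 < K + 2)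
  set q : ℝ := (2 ^ (K + 2))⁻¹ with hqdef
  have hq : 0 < q := by positivity
  have hq1 : q < 1 := inv_lt_one_of_one_lt₀ (one_lt_pow₀ one_lt_two (by omega))
  have hqL : q * L ≤ 1 / 2 := by
    rw [hqdef, inv_mul_le_iff₀ (by positivity), pow_add]
    linarith
  obtain ⟨-, hfast⟩ := hfast
  obtain ⟨δ, C, c₁, c₂, r, -, hC, -, -, -, hT⟩ := hfast γ hγ1
  refine ⟨C ^ 2 * (1 + 2 * L), by positivity, fun n hn x => ?_⟩
  obtain ⟨T, -, hT, -, -⟩ := hT n hn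
  obtain ⟨hTn, hTx, -, hTb⟩ := hT x
  have hn0 : (0 : ℝ) < n := by exact_mod_cast hn
  -- Used with b = 1 for the global bound and with b = 2^j on the shells. One of the two decay
  -- factors of the square already suffices; the other is bounded by 1.
  have hdecay : ∀ (y : Ω) (b : ℝ), 1 ≤ b → b ≤ 1 + n * d x y →
      |T x y| ^ 2 ≤ C ^ 2 * (b ^ (K + 2))⁻¹ := by
    intro y b hb hby
    have hinv : (1 + n * d x y) ^ (-γ) = ((1 + n * d x y) ^ (K + 2))⁻¹ := by
      rw [Real.rpow_neg (by linarith), hγ, Real.rpow_natCast]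
    have h1 : T x y ≤ C * (b ^ (K + 2))⁻¹ := by
      refine (hTb y).2.trans ?_
      rw [hinv]
      gcongr
    have h2 : (b ^ (K + 2))⁻¹ ≤ 1 := inv_le_one_of_one_le₀ (one_le_pow₀ hb)
    have h3 : 0 ≤ (b ^ (K + 2))⁻¹ := by positivity
    calc |T x y| ^ 2 = T x y ^ 2 := sq_abs _
      _ ≤ (C * (b ^ (K + 2))⁻¹) ^ 2 := pow_le_pow_left₀ (hTb y).1 h1 2
      _ = C ^ 2 * ((b ^ (K + 2))⁻¹ * (b ^ (K + 2))⁻¹) := by ring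
      _ ≤ C ^ 2 * (b ^ (K + 2))⁻¹ := by gcongr; exact mul_le_of_le_one_right h3 h2
  refine (christoffel_le hw.nonneg hTn hTx).trans ?_
  refine integral_mul_weight_le_of_decay hw hball hL hdoub x (by positivity) (by positivity)
    hq.le hq1 hqL (fun y => by positivity) (fun y => ?_) (fun y j hj => ?_)
  · have := hdecay y 1 le_rfl (by have := mul_nonneg hn0.le (hdnn x y); linarith)
    simpa using this
  · have h1 : (2 : ℝ) ^ j ≤ n * d x y := by
      have := mul_le_mul_of_nonneg_left hj hn0.le
      rwa [mul_comm, mul_assoc, one_div, inv_mul_cancel₀ hn0.ne', mul_one] at this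
    have := hdecay y (2 ^ j) (one_le_pow₀ one_le_two) (by linarith)
    rwa [← pow_mul, mul_comm j, pow_mul, ← inv_pow] at this

/-! ### Orthogonal projection and reproducing kernels -/

section Orthogonality

variable {D : ℕ} {Ω : Set (EuclideanSpace ℝ (Fin D))} {m : Measure Ω} {w : Ω → ℝ}

theorem weightedInner_comm (f g : Ω → ℝ) : weightedInner m w f g = weightedInner m w g f := by
  unfold weightedInner
  congr 1; ext y; ring

theorem weightedInner_smul_left (c : ℝ) (f g : Ω → ℝ) :
    weightedInner m w (c • f) g = c * weightedInner m w f g := by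
  unfold weightedInner
  rw [← integral_const_mul]
  congr 1; ext y; simp only [Pi.smul_apply, smul_eq_mul]; ring

theorem polySpace_mono {j k : ℕ} (h : j ≤ k) : polySpace Ω j ≤ polySpace Ω k := by
  refine Submodule.map_mono fun p hp => ?_
  rw [MvPolynomial.mem_restrictTotalDegree] at hp ⊢
  exact hp.trans h

theorem IsPolyInnerProduct.integrable_mul (hw : IsPolyInnerProduct m w) {k : ℕ} {f g : Ω → ℝ}
    (hf : f ∈ polySpace Ω k) (hg : g ∈ polySpace Ω k) :
    Integrable (fun y => f y * g y * w y) m := by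
  obtain ⟨p, -, rfl⟩ := hf
  obtain ⟨q, -, rfl⟩ := hg
  simpa [polyRestrict] using hw.integrable (p * q)

theorem IsPolyInnerProduct.weightedInner_add_left (hw : IsPolyInnerProduct m w) {k : ℕ}
    {f₁ f₂ g : Ω → ℝ} (h₁ : f₁ ∈ polySpace Ω k) (h₂ : f₂ ∈ polySpace Ω k)
    (hg : g ∈ polySpace Ω k) :
    weightedInner m w (f₁ + f₂) g = weightedInner m w f₁ g + weightedInner m w f₂ g := by
  unfold weightedInner
  rw [← integral_add (hw.integrable_mul h₁ hg) (hw.integrable_mul h₂ hg)]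
  congr 1; ext y; simp only [Pi.add_apply]; ring

theorem IsPolyInnerProduct.weightedInner_self_pos (hw : IsPolyInnerProduct m w) {k : ℕ}
    {f : Ω → ℝ} (hf : f ∈ polySpace Ω k) (hne : f ≠ 0) : 0 < weightedInner m w f f := by
  obtain ⟨p, -, rfl⟩ := hf
  exact hw.pos_def p hne

/-- Orthogonal projection onto `Π_k(Ω)` inside `Π_n(Ω)`. -/
theorem IsPolyInnerProduct.exists_projection (hw : IsPolyInnerProduct m w) {k n : ℕ}
    (hkn : k ≤ n) {g : Ω → ℝ} (hg : g ∈ polySpace Ω n) :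
    ∃ h ∈ polySpace Ω k, ∀ f ∈ polySpace Ω k, weightedInner m w (g - h) f = 0 := by
  have : Module.Finite ℝ (polySpace Ω k) := by unfold polySpace; infer_instance
  let B : polySpace Ω k →ₗ[ℝ] polySpace Ω k →ₗ[ℝ] ℝ := LinearMap.mk₂ ℝ
    (fun f g => weightedInner m w (f : Ω → ℝ) (g : Ω → ℝ))
    (fun f₁ f₂ g => hw.weightedInner_add_left f₁.2 f₂.2 g.2)
    (fun c f g => weightedInner_smul_left c _ _)
    (fun f g₁ g₂ => by
      rw [weightedInner_comm, weightedInner_comm (f : Ω → ℝ) g₁,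
        weightedInner_comm (f : Ω → ℝ) g₂]
      exact hw.weightedInner_add_left g₁.2 g₂.2 f.2)
    (fun c f g => by
      rw [weightedInner_comm, weightedInner_comm (f : Ω → ℝ) g]
      exact weightedInner_smul_left c _ _)
  -- Positive definiteness makes `B` injective, hence onto the dual by finite dimension; the
  -- projection is the Riesz representative of f ↦ ⟨f, g⟩.
  have hinj : Function.Injective B := by
    rw [injective_iff_map_eq_zero]
    intro f hf
    by_contra hne
    have h0 : B f f = 0 := by rw [hf]; rfl
    exact absurd h0 (hw.weightedInner_self_pos f.2 (by simpa using hne)).ne'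
  have hsurj : Function.Surjective B :=
    (LinearMap.injective_iff_surjective_of_finrank_eq_finrank
      (Subspace.dual_finrank_eq (K := ℝ) (V := polySpace Ω k)).symm).1 hinj
  let φ : polySpace Ω k →ₗ[ℝ] ℝ :=
    { toFun := fun f => weightedInner m w (f : Ω → ℝ) g
      map_add' := fun f₁ f₂ => hw.weightedInner_add_left (polySpace_mono hkn f₁.2)
        (polySpace_mono hkn f₂.2) hg
      map_smul' := fun c f => weightedInner_smul_left c _ _ }
  obtain ⟨h, hh⟩ := hsurj φ
  refine ⟨h, h.2, fun f hf => ?_⟩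
  have h1 : weightedInner m w (h : Ω → ℝ) f = weightedInner m w f g :=
    LinearMap.congr_fun hh ⟨f, hf⟩
  have hf' := polySpace_mono hkn hf
  have hh' := polySpace_mono hkn h.2
  rw [sub_eq_add_neg, ← neg_one_smul ℝ (h : Ω → ℝ),
    hw.weightedInner_add_left hg (Submodule.smul_mem _ _ hh') hf',
    weightedInner_smul_left, h1, weightedInner_comm g f]
  ring

theorem isReproducingKernel_reproducingKernel (hw : IsPolyInnerProduct m w) (k : ℕ) :
    IsReproducingKernel m w k (reproducingKernel m w k) := by
  have h := (existsUnique_reproducingKernel m w hw k).exists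
  rw [reproducingKernel, dif_pos h]
  exact h.choose_spec

/-- The reproducing property applied to P_k(x, ·) itself gives P_k(x, x) = ⟨P_k(x, ·), P_k(x, ·)⟩.
-/
theorem reproducingKernel_self_nonneg (hw0 : ∀ x, 0 ≤ w x) (hw : IsPolyInnerProduct m w)
    (k : ℕ) (x : Ω) : 0 ≤ reproducingKernel m w k x x := by
  obtain ⟨h1, h2⟩ := isReproducingKernel_reproducingKernel hw k
  rw [← h2 _ (h1 x) x]
  exact integral_nonneg fun y => mul_nonneg (mul_self_nonneg _) (hw0 y)

/-- The sum of the first reproducing kernels as a function of the second variable. -/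
noncomputable def partialKernel (m : Measure Ω) (w : Ω → ℝ) (n : ℕ) (x : Ω) : Ω → ℝ :=
  ∑ k ∈ Finset.range (n + 1), reproducingKernel m w k x

theorem partialKernel_mem (hw : IsPolyInnerProduct m w) (n : ℕ) (x : Ω) :
    partialKernel m w n x ∈ polySpace Ω n :=
  Submodule.sum_mem _ fun k hk => polySpace_mono (Nat.lt_succ_iff.1 (Finset.mem_range.1 hk))
    ((isReproducingKernel_reproducingKernel hw k).1 x).1

/-- The partial sums of the reproducing kernels reproduce `Π_n(Ω)`. -/
theorem weightedInner_partialKernel (hw : IsPolyInnerProduct m w) (n : ℕ) (x : Ω) :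
    ∀ g ∈ polySpace Ω n, weightedInner m w (partialKernel m w n x) g = g x := by
  induction n with
  | zero =>
    intro g hg
    rw [weightedInner_comm]
    simpa [partialKernel, weightedInner] using
      (isReproducingKernel_reproducingKernel hw 0).2 g ⟨hg, by simp⟩ x
  | succ n ih =>
    intro g hg
    obtain ⟨hP, hP'⟩ := isReproducingKernel_reproducingKernel hw (n + 1)
    obtain ⟨h, hh, hproj⟩ := hw.exists_projection n.le_succ hg
    have hh1 : h ∈ polySpace Ω (n + 1) := polySpace_mono n.le_succ hh
    have hgh : g - h ∈ polySpace Ω (n + 1) := sub_mem hg hh1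
    -- In the splitting g = (g - h) + h, the old kernel reproduces h and the new one reproduces g -
    -- h; both cross terms vanish by orthogonality.
    have hK : partialKernel m w n x ∈ polySpace Ω (n + 1) :=
      polySpace_mono n.le_succ (partialKernel_mem hw n x)
    have hortho : g - h ∈ orthoPolys m w (n + 1) :=
      ⟨hgh, fun k hk f hf => hproj f (polySpace_mono (Nat.lt_succ_iff.1 hk) hf)⟩
    have hsplit : partialKernel m w (n + 1) x
        = partialKernel m w n x + reproducingKernel m w (n + 1) x :=
      Finset.sum_range_succ _ _
    have e1 : weightedInner m w (partialKernel m w n x) (g - h) = 0 := by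
      rw [weightedInner_comm]
      exact hproj _ (partialKernel_mem hw n x)
    have e2 : weightedInner m w (reproducingKernel m w (n + 1) x) (g - h) = g x - h x := by
      rw [weightedInner_comm]
      exact hP' _ hortho x
    have e3 : weightedInner m w (reproducingKernel m w (n + 1) x) h = 0 :=
      (hP x).2 n n.lt_succ_self h hh
    have e4 := ih h hh
    calc weightedInner m w (partialKernel m w (n + 1) x) g
        = weightedInner m w ((g - h) + h) (partialKernel m w (n + 1) x) := by
          rw [weightedInner_comm, sub_add_cancel]
      _ = weightedInner m w (partialKernel m w n x + reproducingKernel m w (n + 1) x) (g - h)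
          + weightedInner m w (partialKernel m w n x + reproducingKernel m w (n + 1) x) h := by
          rw [hw.weightedInner_add_left hgh hh1 (partialKernel_mem hw _ x), hsplit,
            weightedInner_comm (g - h), weightedInner_comm h]
      _ = g x := by
          rw [hw.weightedInner_add_left hK (hP x).1 hgh,
            hw.weightedInner_add_left hK (hP x).1 hh1, e1, e2, e3, e4]
          ring

/-! ### Lower bound for the Christoffel function -/

/-- The extremal property of the reproducing kernel on the diagonal. -/
theorem one_le_weightedInner_mul_partialKernel (hw0 : ∀ x, 0 ≤ w x)
    (hw : IsPolyInnerProduct m w) {n : ℕ} {x : Ω} {g : Ω → ℝ} (hg : g ∈ polySpace Ω n)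
    (hx : g x = 1) : 1 ≤ weightedInner m w g g * partialKernel m w n x x := by
  have hK := partialKernel_mem hw n x
  set I := weightedInner m w g g with hI
  have hIpos : 0 < I := hw.weightedInner_self_pos hg (by rintro rfl; simp at hx)
  set K := partialKernel m w n x with hKdef
  have e1 : weightedInner m w K g = 1 := (weightedInner_partialKernel hw n x g hg).trans hx
  have e2 : weightedInner m w K K = K x := weightedInner_partialKernel hw n x K hK
  have hIK : (-I) • K ∈ polySpace Ω n := Submodule.smul_mem _ _ hK
  have hsum := add_mem hg hIK
  -- Cauchy–Schwarz by hand: expand the square norm of g - I K, using ⟨K, g⟩ = g(x) = 1 and ⟨K, K⟩ =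
  -- K(x). Nonnegativity gives I ≤ I² K(x), and I > 0 cancels.
  have hexp : weightedInner m w (g + (-I) • K) (g + (-I) • K) = I - 2 * I + I ^ 2 * K x := by
    rw [hw.weightedInner_add_left hg hIK hsum, weightedInner_comm g, weightedInner_smul_left,
      weightedInner_comm K, hw.weightedInner_add_left hg hIK hg,
      hw.weightedInner_add_left hg hIK hK, weightedInner_smul_left, weightedInner_smul_left,
      weightedInner_comm g K, e1, e2, ← hI]
    ring
  have hnonneg : 0 ≤ weightedInner m w (g + (-I) • K) (g + (-I) • K) :=
    integral_nonneg fun y => mul_nonneg (mul_self_nonneg _) (hw0 y)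
  have : I * 1 ≤ I * (I * K x) := by linarith [hexp ▸ hnonneg, sq I]
  exact le_of_mul_le_mul_left this hIpos

/-- On the diagonal every term of the cut-off sum is nonnegative, and those with k ≤ n carry weight
exactly 1. -/
theorem partialKernel_self_le_localizedKernel (hw0 : ∀ x, 0 ≤ w x)
    (hw : IsPolyInnerProduct m w) {a : ℝ → ℝ} (ha : IsCutoffA a) {n : ℕ} (hn : 1 ≤ n) (x : Ω) :
    partialKernel m w n x x ≤ localizedKernel m w a n x x := by
  have hn0 : (0 : ℝ) < n := by exact_mod_cast hn
  have hsum : Summable fun k : ℕ => a ((k : ℝ) / n) * reproducingKernel m w k x x := by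
    refine summable_of_ne_finset_zero (s := Finset.range (2 * n + 1)) fun k hk => ?_
    rw [Finset.mem_range, not_lt] at hk
    rw [ha.eq_zero, zero_mul]
    rw [lt_div_iff₀ hn0]
    exact_mod_cast hk
  have hle := hsum.sum_le_tsum (Finset.range (n + 1)) fun k _ =>
    mul_nonneg (ha.nonneg _ (by positivity)) (reproducingKernel_self_nonneg hw0 hw k x)
  refine le_of_eq_of_le ?_ hle
  rw [partialKernel, Finset.sum_apply]
  refine Finset.sum_congr rfl fun k hk => ?_
  rw [ha.eq_one _ ⟨by positivity, ?_⟩, one_mul]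
  rw [div_le_one hn0]
  exact_mod_cast Nat.lt_succ_iff.1 (Finset.mem_range.1 hk)

/-- Lower bound for the Christoffel function from localized kernels. -/
theorem le_christoffel_of_localizedDecay {d : Ω → Ω → ℝ} (hd : IsDistance d) {a : ℝ → ℝ}
    (ha : IsCutoffA a) (hw0 : ∀ x, 0 ≤ w x) (hw : IsPolyInnerProduct m w)
    (hdecay : AdmitsLocalizedDecay d m w a) :
    ∃ c : ℝ, 0 < c ∧ ∀ n : ℕ, 1 ≤ n → ∀ x : Ω,
      c * weightMass m w (dBall d x (1 / n)) ≤ christoffel m w n x := by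
  -- Any exponent would do: the estimate is used only at y = x, where the decay factor is 1.
  obtain ⟨C, hC, hdecay⟩ := hdecay 1 one_pos
  refine ⟨C⁻¹, inv_pos.2 hC, fun n hn x => le_csInf ?_ ?_⟩
  -- The constant polynomial 1 shows that the infimum is over a nonempty set.
  · refine ⟨_, 1, ⟨1, ?_, ?_⟩, rfl, rfl⟩
    · rw [SetLike.mem_coe, MvPolynomial.mem_restrictTotalDegree]
      simp
    · ext y; simp [polyRestrict]
  rintro _ ⟨g, hg, hgx, rfl⟩
  set M := weightMass m w (dBall d x (1 / n)) with hMdef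
  have hM : 0 ≤ M := weightMass_nonneg hw0 _
  have hI : ∫ y, |g y| ^ 2 * w y ∂m = weightedInner m w g g := by
    simp only [weightedInner, sq_abs]
    simp only [sq]
  have hI0 : 0 ≤ weightedInner m w g g :=
    integral_nonneg fun y => mul_nonneg (mul_self_nonneg _) (hw0 y)
  have hLM : |localizedKernel m w a n x x| * M ≤ C := by
    have h := hdecay n hn x x
    rwa [(hd.eq_zero_iff x x).2 rfl, mul_zero, add_zero, Real.one_rpow, mul_one,
      Real.mul_self_sqrt hM] at h
  have h1 := one_le_weightedInner_mul_partialKernel hw0 hw hg hgx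
  have h2 := (partialKernel_self_le_localizedKernel hw0 hw ha hn x).trans (le_abs_self _)
  rw [hI, inv_mul_le_iff₀ hC]
  calc M = 1 * M := (one_mul M).symm
    _ ≤ weightedInner m w g g * |localizedKernel m w a n x x| * M := by
        gcongr
        exact h1.trans (by gcongr)
    _ = |localizedKernel m w a n x x| * M * weightedInner m w g g := by ring
    _ ≤ C * weightedInner m w g g := by gcongr

end Orthogonality

theorem mainTheorem10 {D : ℕ} (Ω : Set (EuclideanSpace ℝ (Fin D))) (d : Ω → Ω → ℝ)
    (hd : IsDistance d) (hball : ∀ (x : Ω) (r : ℝ), MeasurableSet (dBall d x r))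
    (m : Measure Ω) (w : Ω → ℝ) :
    (HasFastDecayingPolynomials Ω d → IsDoublingWeight d m w →
      ∃ c : ℝ, 0 < c ∧ ∀ n : ℕ, 1 ≤ n → ∀ x : Ω,
        christoffel m w n x ≤ c * weightMass m w (dBall d x (1 / n))) ∧
    (∀ a : ℝ → ℝ, IsCutoffA a → IsWeight m w → IsPolyInnerProduct m w →
      AdmitsLocalizedDecay d m w a →
      ∃ c : ℝ, 0 < c ∧ ∀ n : ℕ, 1 ≤ n → ∀ x : Ω,
        c * weightMass m w (dBall d x (1 / n)) ≤ christoffel m w n x) :=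
  ⟨fun hfast hw => christoffel_le_of_doubling hd hball hfast hw,
    fun _ ha hwt hw hdecay => le_christoffel_of_localizedDecay hd ha hwt.nonneg hw hdecay⟩
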